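/- Let $\lambda$ be a Young diagram, drawn with left-justified rows stacked upwards (French convention), so that the box in row $r$ and column $c$ has coordinates $(x,y)=(c,r)$. The dimension $\dim\mu$ of a Young diagram $\mu$ is the number of standard Young tableaux of shape $\mu$. Let $\lambda_{\mathrm{sym}}$ be the largest subdiagram of $\lambda$ that is symmetric with respect to the line $y=x$, let $A=\lambda\setminus\lambda_{\mathrm{sym}}$ be the set of boxes of $\lambda$ outside it, and suppose that each row and each column of $\lambda$ contains at most one box of $A$. Let $A_u$ and $A_d$ be the sets of boxes of $A$ lying above, respectively below, the line $y=x$, and let $\widetilde{A_d}$ be the reflection of $A_d$ in this line. Then $\lambda'=\lambda_{\mathrm{sym}}\cup A_u\cup\widetilde{A_d}$ is a Young diagram with the same number of boxes as $\lambda$, and $\dim\lambda'\ge\dim\lambda$. If $A_u$ and $A_d$ are both nonempty, then $\dim\lambda'>\dim\lambda$. -/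

import Mathlib

namespace YoungDiagram

/-- A Young diagram that is invariant under reflection in the main diagonal. -/
def IsSymmetric (μ : YoungDiagram) : Prop :=
  μ.transpose = μ

/-- The base subdiagram: the largest symmetric subdiagram
(see `isGreatest_baseSubdiagram`). -/
def baseSubdiagram (μ : YoungDiagram) : YoungDiagram :=
  μ ⊓ μ.transpose

theorem isGreatest_baseSubdiagram (μ : YoungDiagram) :
    IsGreatest {ν : YoungDiagram | ν.IsSymmetric ∧ ν ≤ μ} μ.baseSubdiagram := by
  refine ⟨⟨?_, inf_le_left⟩, ?_⟩
  · unfold IsSymmetric baseSubdiagram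
    ext c
    simp only [mem_cells, mem_transpose, mem_inf, Prod.swap_swap]
    exact and_comm
  · rintro ν ⟨hs, hle⟩
    refine le_inf hle ?_
    have h := YoungDiagram.transpose_mono hle
    rwa [show ν.transpose = ν from hs] at h

/-- The boxes of `μ` outside its base subdiagram. -/
def asymBoxes (μ : YoungDiagram) : Finset (ℕ × ℕ) :=
  μ.cells \ μ.baseSubdiagram.cells

/-- The boxes outside the base subdiagram that lie above the line `y = x`. A cell `c` lies in row
`c.1` and column `c.2`; with rows stacked upwards, its `x`-coordinate is `c.2` and its
`y`-coordinate is `c.1`. -/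
def asymAbove (μ : YoungDiagram) : Finset (ℕ × ℕ) :=
  μ.asymBoxes.filter fun c => c.2 < c.1

/-- The boxes outside the base subdiagram that lie below the line `y = x`. -/
def asymBelow (μ : YoungDiagram) : Finset (ℕ × ℕ) :=
  μ.asymBoxes.filter fun c => c.1 < c.2

/-- A standard Young tableau of shape `μ`: a filling of the `n` boxes of `μ` by the numbers
`1, …, n`, each used exactly once, that increases along rows and columns. -/
structure StandardTableau (μ : YoungDiagram) where
  entry : μ.cells ≃ Finset.Icc 1 μ.card
  row_lt : ∀ c d : μ.cells, c.1.1 = d.1.1 → c.1.2 < d.1.2 → entry c < entry d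
  col_lt : ∀ c d : μ.cells, c.1.2 = d.1.2 → c.1.1 < d.1.1 → entry c < entry d

/-- The dimension of a Young diagram: the number of its standard Young tableaux. -/
noncomputable def dim (μ : YoungDiagram) : ℕ :=
  Nat.card μ.StandardTableau

/-- There are finitely many standard tableaux of a given shape, so that `dim` counts them. -/
instance (μ : YoungDiagram) : Finite μ.StandardTableau :=
  Finite.of_injective (fun T => T.entry) fun S T h => by
    cases S
    cases T
    cases h
    rfl

end YoungDiagram

/-! ### An interpolation identity for the sum over corners. -/

section Interpolation

open Polynomial

variable {ι : Type*} [DecidableEq ι]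

/-! By the hook length formula `dim_mul_hookProd`, dimensions of diagrams of equal size compare
inversely to hook products, so the point is that λ' has the smaller hook product. Since no row or
column contains two boxes of A, each box of A, and hence its reflection, is addable to the symmetric
base σ. Both λ and λ' are therefore σ plus addable boxes; these have hook length 1, and a hook of σ
grows by one for a new box in its row and by one for a new box in its column
(`hookProd_of_cells_eq_union`).

Multiply the hooks of a cell of σ and of its mirror image. Reflecting a box exchanges the row and
column roles of its two coordinates, and this changes the product only if one index of the cell
comes from a box of U = A_u and the other from a box of V, the reflection of A_d. On the side of the
diagonal where the row index is larger, such cells come in pairs: for boxes k, l from different sets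
with l.2 < k.2, they are (k.2, l.2) and (k.1, l.2), with hooks a > b in σ. Together with their
mirror images they contribute a(a+2)(b+1)² to λ and (a+1)²b(b+2) to λ'. The latter is smaller, since
t(t+2)/(t+1)² = 1 - 1/(t+1)² increases. If U and V are nonempty, such a pair exists, whence
strictness. This is `IsSymmetric.prod_hookLength_add_compare`.

The hook length formula itself follows by induction from the branching rule once the ratios of the
hook product of μ to those of μ minus a corner are known to sum to the size of μ
(`sum_hookProd_div`). In beta numbers, removing a corner lowers one number by 1, and the sum becomes
the interpolation identity `sum_mul_prod_erase_sub_one_div`. -/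

/-- The polynomial `X P(X - 1) - X P(X) + n P(X)`, where `P` is the monic polynomial with the
`n` roots `x i`, `i ∈ s`. -/
noncomputable def shiftRemainder (s : Finset ι) (x : ι → ℚ) : ℚ[X] :=
  X * Lagrange.nodal s (fun i => x i + 1) - X * Lagrange.nodal s x +
    C (s.card : ℚ) * Lagrange.nodal s x

theorem shiftRemainder_insert {s : Finset ι} {a : ι} (ha : a ∉ s) (x : ι → ℚ) :
    shiftRemainder (insert a s) x =
      X * shiftRemainder s x - C (x a + 1) * shiftRemainder s x +
        C ((s.card : ℚ) - x a) * Lagrange.nodal s x := by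
  simp only [shiftRemainder, Lagrange.nodal_insert_eq_nodal ha, Finset.card_insert_of_notMem ha,
    map_add, map_sub, map_natCast, map_one, Nat.cast_add, Nat.cast_one]
  ring

/-- The term `n P(X)` cancels the leading term of `X (P(X - 1) - P(X))`. Multiplying by `X` reads
off the coefficient of degree `n - 1` without a subtraction, so the empty set needs no exception. -/
theorem degree_shiftRemainder_lt_and_coeff (s : Finset ι) (x : ι → ℚ) :
    (shiftRemainder s x).degree < s.card ∧
      (X * shiftRemainder s x).coeff s.card = (s.card.choose 2 : ℚ) - ∑ i ∈ s, x i := by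
  induction s using Finset.induction_on with
  | empty => simp [shiftRemainder]
  | insert a s ha ih =>
    obtain ⟨hdeg, hcoeff⟩ := ih
    have hP : (Lagrange.nodal s x).coeff s.card = 1 := by
      have h := (Lagrange.nodal_monic (s := s) (v := x)).coeff_natDegree
      rwa [Lagrange.natDegree_nodal] at h
    rw [shiftRemainder_insert ha, Finset.card_insert_of_notMem ha]
    constructor
    · rw [Polynomial.degree_lt_iff_coeff_zero]
      intro m hm
      obtain ⟨m, rfl⟩ : ∃ m', m = m' + 1 := ⟨m - 1, by omega⟩
      rw [Polynomial.degree_lt_iff_coeff_zero] at hdeg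
      have h3 : (Lagrange.nodal s x).coeff (m + 1) = 0 := by
        apply Polynomial.coeff_eq_zero_of_natDegree_lt
        rw [Lagrange.natDegree_nodal]
        omega
      simp only [coeff_add, coeff_sub, coeff_X_mul, coeff_C_mul, hdeg m (by omega),
        hdeg (m + 1) (by omega), h3]
      simp
    · rw [coeff_X_mul, coeff_add, coeff_sub, hcoeff, coeff_C_mul, coeff_C_mul, hP,
        Polynomial.coeff_eq_zero_of_degree_lt hdeg, Finset.sum_insert ha, Nat.choose_succ_succ' _ 1]
      push_cast
      simp
      ring

/-- At a node `P` vanishes, so `shiftRemainder` takes the value `x i * P(x i - 1)`. Lagrange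
interpolation expresses its coefficient of degree `n - 1` through these values. -/
theorem sum_mul_prod_erase_sub_one_div (s : Finset ι) (x : ι → ℚ) (hx : Set.InjOn x s) :
    ∑ i ∈ s, x i * ∏ j ∈ s.erase i, ((x i - 1 - x j) / (x i - x j)) =
      ∑ i ∈ s, x i - (s.card.choose 2 : ℚ) := by
  obtain ⟨hdeg, hcoeff⟩ := degree_shiftRemainder_lt_and_coeff s x
  rcases s.eq_empty_or_nonempty with rfl | hs
  · simp
  have h := Lagrange.coeff_eq_sum hx hdeg
  have hc : s.card = (s.card - 1) + 1 := by have := hs.card_pos; omega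
  rw [hc, coeff_X_mul, ← hc, h] at hcoeff
  rw [← neg_sub, ← hcoeff, ← Finset.sum_neg_distrib]
  refine Finset.sum_congr rfl fun i hi => ?_
  have hev : (shiftRemainder s x).eval (x i) =
      -(x i * ∏ j ∈ s.erase i, (x i - 1 - x j)) := by
    simp only [shiftRemainder, eval_add, eval_sub, eval_mul, eval_X, eval_C,
      Lagrange.eval_nodal_at_node hi]
    rw [Lagrange.eval_nodal, ← Finset.mul_prod_erase _ _ hi]
    simp only [sub_add_eq_sub_sub_swap]
    ring
  rw [hev, Finset.prod_div_distrib]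
  ring

end Interpolation

/-! ### Change of one variable in a difference product. -/

section Vandermonde

/-- Lowering one of the variables changes the difference product by the expected factor. -/
theorem prod_prod_Ioo_sub_update (k : ℕ) (x : ℕ → ℚ) (i : ℕ) (hi : i < k) (t : ℚ)
    (hx : ∀ a < k, ∀ b < k, a ≠ b → x a ≠ x b) :
    ∏ a ∈ Finset.range k, ∏ b ∈ Finset.Ioo a k,
        (Function.update x i t a - Function.update x i t b) =
      (∏ a ∈ Finset.range k, ∏ b ∈ Finset.Ioo a k, (x a - x b)) *
        ∏ j ∈ (Finset.range k).erase i, ((t - x j) / (x i - x j)) := by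
  -- The quotient of the new factor by the old one; it is 1 unless the pair involves `i`.
  set r : ℕ → ℕ → ℚ := fun a b =>
    (Function.update x i t a - Function.update x i t b) / (x a - x b) with hr
  have hIoo : ∀ (a : ℕ) (f : ℕ → ℚ), ∏ b ∈ Finset.Ioo a k, f b =
      ∏ b ∈ Finset.range k, if a < b then f b else 1 := by
    intro a f
    rw [← Finset.prod_filter]
    refine Finset.prod_congr ?_ fun _ _ => rfl
    ext b
    simp [and_comm]
  have key : ∏ a ∈ Finset.range k, ∏ b ∈ Finset.Ioo a k, r a b =
      ∏ j ∈ (Finset.range k).erase i, r i j := by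
    have hmem : i ∈ Finset.range k := Finset.mem_range.2 hi
    rw [← Finset.mul_prod_erase _ _ hmem, hIoo, ← Finset.mul_prod_erase _ _ hmem,
      if_neg (lt_irrefl i), one_mul, ← Finset.prod_mul_distrib]
    refine Finset.prod_congr rfl fun a ha => ?_
    obtain ⟨hai, hak⟩ := Finset.mem_erase.1 ha
    rw [Finset.mem_range] at hak
    have h1 : ∏ b ∈ Finset.Ioo a k, r a b = if a < i then r a i else 1 := by
      rw [hIoo, Finset.prod_eq_single_of_mem i hmem]
      intro b hb hbi
      split_ifs with hab
      · simp only [hr, Function.update_of_ne hai, Function.update_of_ne hbi]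
        exact div_self (sub_ne_zero.2 (hx a hak b (Finset.mem_range.1 hb) hab.ne))
      · rfl
    rw [h1]
    rcases lt_or_gt_of_ne hai with h | h
    · rw [if_neg h.not_gt, if_pos h, one_mul]
      simp only [hr]
      rw [← neg_sub, ← neg_sub (x i), neg_div_neg_eq]
    · rw [if_pos h, if_neg h.not_gt, mul_one]
  have hkey2 : ∏ j ∈ (Finset.range k).erase i, ((t - x j) / (x i - x j)) =
      ∏ j ∈ (Finset.range k).erase i, r i j := by
    refine Finset.prod_congr rfl fun j hj => ?_
    simp only [hr, Function.update_self, Function.update_of_ne (Finset.ne_of_mem_erase hj)]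
  rw [hkey2, ← key, ← Finset.prod_mul_distrib]
  refine Finset.prod_congr rfl fun a ha => ?_
  rw [← Finset.prod_mul_distrib]
  refine Finset.prod_congr rfl fun b hb => ?_
  rw [Finset.mem_range] at ha
  rw [Finset.mem_Ioo] at hb
  have := sub_ne_zero.2 (hx a ha b hb.2 hb.1.ne)
  simp only [hr]
  field_simp

end Vandermonde

/-! ### Hook lengths and beta numbers. -/

namespace YoungDiagram

section Hooks

/-- The hook length of the cell `c`: the number of cells of `μ` weakly to the right of `c` in its
row or strictly beyond `c` in its column. -/
def hookLength (μ : YoungDiagram) (c : ℕ × ℕ) : ℕ :=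
  (μ.rowLen c.1 - c.2 - 1) + (μ.colLen c.2 - c.1 - 1) + 1

/-- The product of all hook lengths. -/
def hookProd (μ : YoungDiagram) : ℕ :=
  ∏ c ∈ μ.cells, μ.hookLength c

theorem hookLength_pos (μ : YoungDiagram) (c : ℕ × ℕ) : 0 < μ.hookLength c :=
  Nat.succ_pos _

theorem hookProd_pos (μ : YoungDiagram) : 0 < μ.hookProd :=
  Finset.prod_pos fun c _ => μ.hookLength_pos c

theorem lt_rowLen_iff_lt_colLen {μ : YoungDiagram} {i j : ℕ} :
    j < μ.rowLen i ↔ i < μ.colLen j :=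
  mem_iff_lt_rowLen.symm.trans mem_iff_lt_colLen

/-- The `i`-th beta number of `μ`, regarded as a partition with `k` parts. -/
def beta (μ : YoungDiagram) (k i : ℕ) : ℕ :=
  μ.rowLen i + (k - 1 - i)

theorem beta_lt_beta (μ : YoungDiagram) {k a b : ℕ} (hab : a < b) (hb : b < k) :
    μ.beta k b < μ.beta k a := by
  have := μ.rowLen_anti a b hab.le
  unfold beta
  omega

theorem fst_lt_of_mem {μ : YoungDiagram} {k : ℕ} (hk : μ.colLen 0 ≤ k) {c : ℕ × ℕ}
    (hc : c ∈ μ.cells) : c.1 < k :=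
  (mem_iff_lt_colLen.1 (μ.up_left_mem le_rfl (Nat.zero_le c.2) hc)).trans_le hk

theorem rowLen_eq_zero {μ : YoungDiagram} {k i : ℕ} (hk : μ.colLen 0 ≤ k) (hi : k ≤ i) :
    μ.rowLen i = 0 := by
  by_contra h
  have := lt_rowLen_iff_lt_colLen.1 (Nat.pos_of_ne_zero h)
  omega

theorem prod_cells_eq_prod_range {M : Type*} [CommMonoid M] (μ : YoungDiagram) {k : ℕ}
    (hk : μ.colLen 0 ≤ k) (f : ℕ × ℕ → M) :
    ∏ c ∈ μ.cells, f c = ∏ i ∈ Finset.range k, ∏ j ∈ Finset.range (μ.rowLen i), f (i, j) := by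
  rw [← Finset.prod_fiberwise_of_maps_to (t := Finset.range k) (g := Prod.fst)
    fun c hc => Finset.mem_range.2 (fst_lt_of_mem hk hc)]
  refine Finset.prod_congr rfl fun i _ => ?_
  have h : μ.cells.filter (fun c => c.1 = i) = {i} ×ˢ Finset.range (μ.rowLen i) := row_eq_prod
  rw [h, Finset.prod_product, Finset.prod_singleton]

theorem card_eq_sum_rowLen (μ : YoungDiagram) {k : ℕ} (hk : μ.colLen 0 ≤ k) :
    μ.card = ∑ i ∈ Finset.range k, μ.rowLen i := by
  rw [YoungDiagram.card, Finset.card_eq_sum_card_fiberwise (t := Finset.range k) (f := Prod.fst)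
    fun c hc => Finset.mem_coe.2 (Finset.mem_range.2 (fst_lt_of_mem hk hc))]
  exact Finset.sum_congr rfl fun i _ => μ.rowLen_eq_card.symm

/-- The hook lengths in row `i` together with the differences `beta i - beta b`, `i < b`, exhaust
`1, …, beta i`. -/
theorem prod_hookLength_row_mul (μ : YoungDiagram) {k i : ℕ} (hk : μ.colLen 0 ≤ k) (hi : i < k) :
    (∏ j ∈ Finset.range (μ.rowLen i), μ.hookLength (i, j)) *
      ∏ b ∈ Finset.Ioo i k, (μ.beta k i - μ.beta k b) = (μ.beta k i).factorial := by
  have hinj1 : Set.InjOn (fun j => μ.hookLength (i, j)) (Finset.range (μ.rowLen i)) := by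
    have hlt : ∀ a b, a < b → b < μ.rowLen i → μ.hookLength (i, b) < μ.hookLength (i, a) := by
      intro a b hab hb
      have := μ.colLen_anti a b hab.le
      simp only [hookLength]
      omega
    intro a ha b hb hab
    simp only [Finset.coe_range, Set.mem_Iio] at ha hb hab
    rcases lt_trichotomy a b with h | h | h
    · exact absurd hab (hlt a b h hb).ne'
    · exact h
    · exact absurd hab (hlt b a h ha).ne
  have hinj2 : Set.InjOn (fun b => μ.beta k i - μ.beta k b) (Finset.Ioo i k) := by
    intro a ha b hb hab
    simp only [Finset.coe_Ioo, Set.mem_Ioo] at ha hb hab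
    have h1 := μ.beta_lt_beta ha.1 ha.2
    have h2 := μ.beta_lt_beta hb.1 hb.2
    rcases lt_trichotomy a b with h | h | h
    · have := μ.beta_lt_beta h hb.2
      omega
    · exact h
    · have := μ.beta_lt_beta h ha.2
      omega
  have hdisj : Disjoint ((Finset.range (μ.rowLen i)).image fun j => μ.hookLength (i, j))
      ((Finset.Ioo i k).image fun b => μ.beta k i - μ.beta k b) := by
    rw [Finset.disjoint_left]
    intro m hm1 hm2
    obtain ⟨j, hj, rfl⟩ := Finset.mem_image.1 hm1
    obtain ⟨b, hb, hjb⟩ := Finset.mem_image.1 hm2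
    rw [Finset.mem_range] at hj
    rw [Finset.mem_Ioo] at hb
    have h1 := lt_rowLen_iff_lt_colLen.1 hj
    have h2 := μ.rowLen_anti i b hb.1.le
    -- If `(b, j)` lies in `μ`, the hook length exceeds the beta difference; otherwise it is
    -- smaller.
    have h3 : j < μ.rowLen b ↔ b < μ.colLen j := lt_rowLen_iff_lt_colLen
    simp only [hookLength, beta] at hjb
    omega
  have hunion : ((Finset.range (μ.rowLen i)).image fun j => μ.hookLength (i, j)) ∪
      ((Finset.Ioo i k).image fun b => μ.beta k i - μ.beta k b) =
        Finset.Icc 1 (μ.beta k i) := by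
    apply Finset.eq_of_subset_of_card_le
    · intro m hm
      rw [Finset.mem_Icc]
      rcases Finset.mem_union.1 hm with hm | hm
      · obtain ⟨j, hj, rfl⟩ := Finset.mem_image.1 hm
        rw [Finset.mem_range] at hj
        have h1 := μ.colLen_anti 0 j (Nat.zero_le j)
        simp only [hookLength, beta]
        omega
      · obtain ⟨b, hb, rfl⟩ := Finset.mem_image.1 hm
        rw [Finset.mem_Ioo] at hb
        have := μ.beta_lt_beta hb.1 hb.2
        omega
    · rw [Finset.card_union_of_disjoint hdisj, Finset.card_image_of_injOn hinj1,
        Finset.card_image_of_injOn hinj2, Finset.card_range, Nat.card_Ioo, Nat.card_Icc]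
      simp only [beta]
      omega
  have hfact : (μ.beta k i).factorial = ∏ m ∈ Finset.Icc 1 (μ.beta k i), m := by
    rw [← Finset.prod_range_add_one_eq_factorial, Finset.range_eq_Ico,
      Finset.prod_Ico_add' (fun m => m) 0 _ 1, zero_add, Finset.Ico_add_one_right_eq_Icc]
  rw [hfact, ← hunion, Finset.prod_union hdisj,
    Finset.prod_image hinj1, Finset.prod_image hinj2]

/-- The hook product in terms of the beta numbers. -/
theorem hookProd_mul_prod_beta (μ : YoungDiagram) {k : ℕ} (hk : μ.colLen 0 ≤ k) :
    (μ.hookProd : ℚ) * ∏ a ∈ Finset.range k, ∏ b ∈ Finset.Ioo a k,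
        ((μ.beta k a : ℚ) - μ.beta k b) =
      ∏ a ∈ Finset.range k, ((μ.beta k a).factorial : ℚ) := by
  rw [hookProd, μ.prod_cells_eq_prod_range hk, Nat.cast_prod, ← Finset.prod_mul_distrib]
  refine Finset.prod_congr rfl fun a ha => ?_
  rw [← μ.prod_hookLength_row_mul hk (Finset.mem_range.1 ha), Nat.cast_mul, Nat.cast_prod,
    Nat.cast_prod]
  congr 1
  refine Finset.prod_congr rfl fun b hb => ?_
  rw [Finset.mem_Ioo] at hb
  rw [Nat.cast_sub (μ.beta_lt_beta hb.1 hb.2).le]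

end Hooks

/-! ### Removing a corner, and its effect on the hook product. -/

section Corners

/-- The rows of `μ` whose last cell can be removed. -/
def cornerRows (μ : YoungDiagram) : Finset ℕ :=
  (Finset.range (μ.colLen 0)).filter fun i => μ.rowLen (i + 1) < μ.rowLen i

theorem mem_cornerRows {μ : YoungDiagram} {i : ℕ} :
    i ∈ μ.cornerRows ↔ μ.rowLen (i + 1) < μ.rowLen i := by
  rw [cornerRows, Finset.mem_filter, Finset.mem_range, and_iff_right_iff_imp]
  intro h
  exact lt_rowLen_iff_lt_colLen.1 (by omega)

/-- The diagram `μ` without the cells weakly beyond the last cell of row `i` in both directions.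
If `i` is a corner row, this removes just the last cell of that row. -/
def removeCorner (μ : YoungDiagram) (i : ℕ) : YoungDiagram where
  cells := μ.cells.filter fun c => ¬(i ≤ c.1 ∧ μ.rowLen i - 1 ≤ c.2)
  isLowerSet := by
    intro c d hdc hc
    simp only [Finset.coe_filter, Set.mem_ofPred_eq] at hc ⊢
    refine ⟨μ.isLowerSet hdc hc.1, fun h => hc.2 ⟨h.1.trans hdc.1, h.2.trans hdc.2⟩⟩

theorem mem_removeCorner {μ : YoungDiagram} {i : ℕ} (hi : i ∈ μ.cornerRows) {c : ℕ × ℕ} :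
    c ∈ μ.removeCorner i ↔ c ∈ μ ∧ c ≠ (i, μ.rowLen i - 1) := by
  rw [mem_cornerRows] at hi
  obtain ⟨a, b⟩ := c
  change (a, b) ∈ μ.cells.filter _ ↔ _
  rw [Finset.mem_filter, mem_cells]
  refine and_congr_right fun hc => not_congr ?_
  rw [Prod.mk.injEq]
  rw [mem_iff_lt_rowLen] at hc
  constructor
  · rintro ⟨h1, h2⟩
    dsimp only at h1 h2
    rcases h1.eq_or_lt with rfl | h
    · omega
    · have := μ.rowLen_anti (i + 1) a h
      omega
  · rintro ⟨rfl, rfl⟩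
    exact ⟨le_rfl, le_rfl⟩

theorem corner_mem {μ : YoungDiagram} {i : ℕ} (hi : i ∈ μ.cornerRows) :
    (i, μ.rowLen i - 1) ∈ μ := by
  rw [mem_cornerRows] at hi
  rw [mem_iff_lt_rowLen]
  omega

theorem cells_removeCorner {μ : YoungDiagram} {i : ℕ} (hi : i ∈ μ.cornerRows) :
    (μ.removeCorner i).cells = μ.cells.erase (i, μ.rowLen i - 1) := by
  ext c
  rw [mem_cells, mem_removeCorner hi, Finset.mem_erase, mem_cells, and_comm]

theorem card_removeCorner {μ : YoungDiagram} {i : ℕ} (hi : i ∈ μ.cornerRows) :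
    (μ.removeCorner i).card + 1 = μ.card := by
  rw [YoungDiagram.card, cells_removeCorner hi]
  exact Finset.card_erase_add_one (corner_mem hi)

theorem rowLen_removeCorner {μ : YoungDiagram} {i : ℕ} (hi : i ∈ μ.cornerRows) :
    (μ.removeCorner i).rowLen = Function.update μ.rowLen i (μ.rowLen i - 1) := by
  have key : ∀ a b, b < (μ.removeCorner i).rowLen a ↔
      b < μ.rowLen a ∧ (a, b) ≠ (i, μ.rowLen i - 1) := by
    intro a b
    rw [← mem_iff_lt_rowLen, ← mem_iff_lt_rowLen, mem_removeCorner hi]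
  funext a
  refine eq_of_forall_lt_iff fun b => ?_
  rw [key]
  rcases eq_or_ne a i with rfl | h
  · rw [Function.update_self, Ne, Prod.mk.injEq]
    omega
  · rw [Function.update_of_ne h, Ne, Prod.mk.injEq]
    tauto

theorem colLen_zero_removeCorner_le (μ : YoungDiagram) (i : ℕ) :
    (μ.removeCorner i).colLen 0 ≤ μ.colLen 0 := by
  by_contra! h
  have h1 : (μ.colLen 0, 0) ∈ μ.removeCorner i := mem_iff_lt_colLen.2 h
  have h2 : (μ.colLen 0, 0) ∈ μ := (Finset.mem_filter.1 h1).1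
  exact lt_irrefl _ (mem_iff_lt_colLen.1 h2)

end Corners

/-- Only the beta number of row `i` changes, dropping by one. In `hookProd_mul_prod_beta` the
factorials thus lose the factor `beta k i`, and the difference product changes as in
`prod_prod_Ioo_sub_update`. -/
theorem hookProd_div_hookProd_removeCorner {μ : YoungDiagram} {i : ℕ} (hi : i ∈ μ.cornerRows)
    {k : ℕ} (hk : μ.colLen 0 ≤ k) :
    (μ.hookProd : ℚ) / (μ.removeCorner i).hookProd =
      μ.beta k i * ∏ j ∈ (Finset.range k).erase i,
        (((μ.beta k i : ℚ) - 1 - μ.beta k j) / ((μ.beta k i : ℚ) - μ.beta k j)) := by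
  have hcorner := mem_cornerRows.1 hi
  have hik : i < k := (Finset.mem_range.1 (Finset.mem_filter.1 hi).1).trans_le hk
  set ν := μ.removeCorner i with hν
  have hβ : ν.beta k = Function.update (μ.beta k) i (μ.beta k i - 1) := by
    funext a
    rw [beta, hν, rowLen_removeCorner hi]
    rcases eq_or_ne a i with rfl | h
    · rw [Function.update_self, Function.update_self, beta]
      omega
    · rw [Function.update_of_ne h, Function.update_of_ne h, beta]
  have hpos : 0 < μ.beta k i := by
    unfold beta
    omega
  have hβQ : ∀ a, (ν.beta k a : ℚ) =
      Function.update (fun a => (μ.beta k a : ℚ)) i ((μ.beta k i : ℚ) - 1) a := by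
    intro a
    rw [hβ]
    rcases eq_or_ne a i with rfl | h
    · rw [Function.update_self, Function.update_self, Nat.cast_pred hpos]
    · rw [Function.update_of_ne h, Function.update_of_ne h]
  have hne : ∀ (ρ : YoungDiagram), ∀ a < k, ∀ b < k, a ≠ b → (ρ.beta k a : ℚ) ≠ ρ.beta k b := by
    intro ρ a ha b hb hab
    rcases lt_or_gt_of_ne hab with h | h
    · exact_mod_cast (ρ.beta_lt_beta h hb).ne'
    · exact_mod_cast (ρ.beta_lt_beta h ha).ne
  have h1 := μ.hookProd_mul_prod_beta hk
  have h2 := ν.hookProd_mul_prod_beta ((μ.colLen_zero_removeCorner_le i).trans hk)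
  simp_rw [hβQ] at h2
  rw [prod_prod_Ioo_sub_update k _ i hik _ (hne μ)] at h2
  have h3 : ∏ a ∈ Finset.range k, ((μ.beta k a).factorial : ℚ) =
      μ.beta k i * ∏ a ∈ Finset.range k, ((ν.beta k a).factorial : ℚ) := by
    have hmem : i ∈ Finset.range k := Finset.mem_range.2 hik
    rw [← Finset.mul_prod_erase _ _ hmem, ← Finset.mul_prod_erase _ _ hmem, ← mul_assoc]
    congr 1
    · rw [hβ, Function.update_self, ← Nat.cast_mul, Nat.mul_factorial_pred hpos.ne']
    · refine Finset.prod_congr rfl fun a ha => ?_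
      rw [hβ, Function.update_of_ne (Finset.ne_of_mem_erase ha)]
  rw [h3, ← h2] at h1
  have hD : ∏ a ∈ Finset.range k, ∏ b ∈ Finset.Ioo a k, ((μ.beta k a : ℚ) - μ.beta k b) ≠ 0 := by
    refine Finset.prod_ne_zero_iff.2 fun a ha => Finset.prod_ne_zero_iff.2 fun b hb => ?_
    rw [Finset.mem_Ioo] at hb
    exact sub_ne_zero.2 (hne μ a (Finset.mem_range.1 ha) b hb.2 hb.1.ne)
  have hν0 : (ν.hookProd : ℚ) ≠ 0 := by exact_mod_cast ν.hookProd_pos.ne'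
  rw [div_eq_iff hν0]
  apply mul_right_cancel₀ hD
  rw [h1]
  ring

/-- The formula for the ratio vanishes at rows without a corner, so the sum may run over all rows.
The beta numbers sum to the size of `μ` plus `k.choose 2`, and the interpolation identity removes
the binomial. -/
theorem sum_hookProd_div (μ : YoungDiagram) :
    ∑ i ∈ μ.cornerRows, (μ.hookProd : ℚ) / (μ.removeCorner i).hookProd = μ.card := by
  set k := μ.colLen 0 with hk
  have hinj : Set.InjOn (fun a => (μ.beta k a : ℚ)) (Finset.range k) := by
    intro a ha b hb hab
    simp only [Finset.coe_range, Set.mem_Iio, Nat.cast_inj] at ha hb hab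
    have hab' : μ.beta k a = μ.beta k b := hab
    rcases lt_trichotomy a b with h | h | h
    · exact absurd hab' (μ.beta_lt_beta h hb).ne'
    · exact h
    · exact absurd hab' (μ.beta_lt_beta h ha).ne
  have hsum := sum_mul_prod_erase_sub_one_div (Finset.range k) (fun a => (μ.beta k a : ℚ)) hinj
  rw [Finset.sum_congr rfl fun i hi => hookProd_div_hookProd_removeCorner hi hk.ge,
    Finset.sum_subset (show μ.cornerRows ⊆ Finset.range k from Finset.filter_subset _ _), hsum,
    Finset.card_range,
    μ.card_eq_sum_rowLen hk.ge]
  · have h : ∑ i ∈ Finset.range k, (k - 1 - i) = k.choose 2 := by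
      rw [Finset.sum_range_reflect (fun i => i) k, Finset.sum_range_id, Nat.choose_two_right]
    simp only [beta]
    push_cast
    rw [Finset.sum_add_distrib, ← h]
    push_cast
    ring
  -- A row equal in length to the next one has beta number one larger, which kills a factor; for the
  -- last index the beta number itself is 0.
  · intro i hi hnot
    rw [Finset.mem_range] at hi
    rw [mem_cornerRows, not_lt] at hnot
    have heq : μ.rowLen i = μ.rowLen (i + 1) := le_antisymm hnot (μ.rowLen_anti _ _ (Nat.le_succ i))
    rcases (Nat.succ_le_of_lt hi).eq_or_lt with h | h
    · have h0 : μ.beta k i = 0 := by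
        rw [beta, heq, rowLen_eq_zero hk.ge h.ge]
        omega
      rw [h0]
      simp
    · refine mul_eq_zero_of_right _ (Finset.prod_eq_zero (i := i + 1) ?_ ?_)
      · rw [Finset.mem_erase, Finset.mem_range]
        exact ⟨by omega, h⟩
      · have : μ.beta k i = μ.beta k (i + 1) + 1 := by
          rw [beta, beta, heq]
          omega
        rw [this]
        push_cast
        simp

end YoungDiagram

/-! ### The branching rule and the hook length formula. -/

namespace YoungDiagram

/-- Standard tableaux of shape `μ`, written as functions on all of `ℕ × ℕ` that vanish
outside `μ`. -/
structure IsStandardFilling (μ : YoungDiagram) (f : ℕ × ℕ → ℕ) : Prop where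
  eq_zero : ∀ c, c ∉ μ → f c = 0
  bijOn : Set.BijOn f μ.cells (Set.Icc 1 μ.card)
  row_lt : ∀ c ∈ μ, ∀ d ∈ μ, c.1 = d.1 → c.2 < d.2 → f c < f d
  col_lt : ∀ c ∈ μ, ∀ d ∈ μ, c.2 = d.2 → c.1 < d.1 → f c < f d

/-- Standard tableaux are the same as standard fillings. -/
theorem dim_eq_card_standardFilling (μ : YoungDiagram) :
    μ.dim = Nat.card {f // μ.IsStandardFilling f} := by
  classical
  let ext : μ.StandardTableau → ℕ × ℕ → ℕ :=
    fun T c => if h : c ∈ μ.cells then (T.entry ⟨c, h⟩ : ℕ) else 0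
  have ext_mem : ∀ T c (h : c ∈ μ.cells), ext T c = T.entry ⟨c, h⟩ := fun T c h => dif_pos h
  have hext : ∀ T, μ.IsStandardFilling (ext T) := by
    intro T
    refine ⟨fun c hc => dif_neg hc, ⟨?_, ?_, ?_⟩, ?_, ?_⟩
    · intro c hc
      rw [ext_mem T c hc]
      exact Finset.mem_Icc.1 (T.entry ⟨c, hc⟩).2
    · intro c hc d hd hcd
      rw [ext_mem T c hc, ext_mem T d hd] at hcd
      exact congrArg Subtype.val (T.entry.injective (Subtype.ext hcd))
    · intro m hm
      refine ⟨(T.entry.symm ⟨m, Finset.mem_Icc.2 hm⟩).1, (T.entry.symm _).2, ?_⟩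
      rw [ext_mem T _ (T.entry.symm _).2]
      simp
    · intro c hc d hd h1 h2
      rw [ext_mem T c hc, ext_mem T d hd]
      exact T.row_lt ⟨c, hc⟩ ⟨d, hd⟩ h1 h2
    · intro c hc d hd h1 h2
      rw [ext_mem T c hc, ext_mem T d hd]
      exact T.col_lt ⟨c, hc⟩ ⟨d, hd⟩ h1 h2
  refine Nat.card_congr (Equiv.ofBijective (fun T => ⟨ext T, hext T⟩) ⟨?_, ?_⟩)
  · intro S T hST
    have h : S.entry = T.entry := by
      ext ⟨c, hc⟩
      have := congrFun (congrArg Subtype.val hST) c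
      simpa only [ext_mem _ c hc] using this
    cases S
    cases T
    cases h
    rfl
  · rintro ⟨f, hf⟩
    let e : μ.cells ≃ Finset.Icc 1 μ.card :=
      Equiv.ofBijective (fun c => ⟨f c, Finset.mem_Icc.2 (hf.bijOn.mapsTo c.2)⟩)
        ⟨fun c d hcd => Subtype.ext (hf.bijOn.injOn c.2 d.2 (congrArg Subtype.val hcd)),
          fun m => by
            obtain ⟨c, hc, hcm⟩ := hf.bijOn.surjOn (Finset.mem_Icc.1 m.2)
            exact ⟨⟨c, hc⟩, Subtype.ext hcm⟩⟩
    refine ⟨⟨e, fun c d h1 h2 => hf.row_lt c c.2 d d.2 h1 h2,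
      fun c d h1 h2 => hf.col_lt c c.2 d d.2 h1 h2⟩, Subtype.ext ?_⟩
    funext c
    by_cases hc : c ∈ μ.cells
    · exact ext_mem _ c hc
    · exact (dif_neg hc).trans (hf.eq_zero c hc).symm

instance (μ : YoungDiagram) : Finite {f // μ.IsStandardFilling f} := by
  refine Finite.of_injective
    (fun f (c : μ.cells) => (⟨f.1 c, Nat.lt_succ_of_le (f.2.bijOn.mapsTo c.2).2⟩ :
      Fin (μ.card + 1))) ?_
  intro f g hfg
  refine Subtype.ext (funext fun c => ?_)
  by_cases hc : c ∈ μ.cells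
  · exact congrArg Fin.val (congrFun hfg ⟨c, hc⟩)
  · rw [f.2.eq_zero c hc, g.2.eq_zero c hc]

theorem IsStandardFilling.le_card {μ : YoungDiagram} {f : ℕ × ℕ → ℕ} (hf : μ.IsStandardFilling f)
    (c : ℕ × ℕ) : f c ≤ μ.card := by
  by_cases hc : c ∈ μ.cells
  · exact (hf.bijOn.mapsTo hc).2
  · rw [hf.eq_zero c hc]
    exact Nat.zero_le _

/-- One direction of the branching bijection: the largest entry may be placed in a corner, since no
cell lies beyond it. -/
theorem IsStandardFilling.update_corner {μ : YoungDiagram} {i : ℕ} (hi : i ∈ μ.cornerRows)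
    {g : ℕ × ℕ → ℕ} (hg : (μ.removeCorner i).IsStandardFilling g) :
    μ.IsStandardFilling (Function.update g (i, μ.rowLen i - 1) μ.card) := by
  have hcard := card_removeCorner hi
  have hgt : ∀ c, g c < μ.card := fun c => by have := hg.le_card c; omega
  have hmem : ∀ {c}, c ∈ μ → c ≠ (i, μ.rowLen i - 1) → c ∈ μ.removeCorner i :=
    fun hc hne => (mem_removeCorner hi).2 ⟨hc, hne⟩
  have hlast : ∀ d ∈ μ, ¬(i ≤ d.1 ∧ μ.rowLen i - 1 ≤ d.2 ∧ (i < d.1 ∨ μ.rowLen i - 1 < d.2)) := by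
    rintro ⟨a, b⟩ hd ⟨h1, h2, h3⟩
    have h4 := mem_iff_lt_rowLen.1 hd
    have h5 := mem_cornerRows.1 hi
    rcases h1.eq_or_lt with h | h
    · dsimp only at h h3
      subst h
      omega
    · have := μ.rowLen_anti (i + 1) a h
      dsimp only at h2
      omega
  refine ⟨?_, ⟨?_, ?_, ?_⟩, ?_, ?_⟩
  · intro c hc
    have hne : c ≠ (i, μ.rowLen i - 1) := by
      rintro rfl
      exact hc (corner_mem hi)
    rw [Function.update_of_ne hne]
    exact hg.eq_zero c fun h => hc ((mem_removeCorner hi).1 h).1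
  · intro c hc
    rcases eq_or_ne c (i, μ.rowLen i - 1) with rfl | h
    · rw [Function.update_self]
      exact ⟨by omega, le_rfl⟩
    · rw [Function.update_of_ne h]
      exact ⟨(hg.bijOn.mapsTo (hmem hc h)).1, (hgt c).le⟩
  · intro c hc d hd hcd
    rcases eq_or_ne c (i, μ.rowLen i - 1) with hc' | hc' <;>
      rcases eq_or_ne d (i, μ.rowLen i - 1) with hd' | hd'
    · rw [hc', hd']
    · rw [hc', Function.update_self, Function.update_of_ne hd'] at hcd
      exact absurd hcd (hgt d).ne'
    · rw [hd', Function.update_self, Function.update_of_ne hc'] at hcd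
      exact absurd hcd (hgt c).ne
    · rw [Function.update_of_ne hc', Function.update_of_ne hd'] at hcd
      exact hg.bijOn.injOn (hmem hc hc') (hmem hd hd') hcd
  · rintro m ⟨hm1, hm2⟩
    rcases hm2.eq_or_lt with rfl | h
    · exact ⟨_, corner_mem hi, Function.update_self ..⟩
    · obtain ⟨c, hc, rfl⟩ := hg.bijOn.surjOn (show m ∈ Set.Icc 1 _ from ⟨hm1, by omega⟩)
      have hc' := (mem_removeCorner hi).1 hc
      exact ⟨c, hc'.1, Function.update_of_ne hc'.2 ..⟩
  · intro c hc d hd h1 h2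
    have hc' : c ≠ (i, μ.rowLen i - 1) := by
      rintro rfl
      exact hlast d hd ⟨h1.le, h2.le, Or.inr h2⟩
    rw [Function.update_of_ne hc']
    rcases eq_or_ne d (i, μ.rowLen i - 1) with rfl | hd'
    · rw [Function.update_self]
      exact hgt c
    · rw [Function.update_of_ne hd']
      exact hg.row_lt c (hmem hc hc') d (hmem hd hd') h1 h2
  · intro c hc d hd h1 h2
    have hc' : c ≠ (i, μ.rowLen i - 1) := by
      rintro rfl
      exact hlast d hd ⟨h2.le, h1.le, Or.inl h2⟩
    rw [Function.update_of_ne hc']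
    rcases eq_or_ne d (i, μ.rowLen i - 1) with rfl | hd'
    · rw [Function.update_self]
      exact hgt c
    · rw [Function.update_of_ne hd']
      exact hg.col_lt c (hmem hc hc') d (hmem hd hd') h1 h2

/-- A further cell in the row or column of the largest entry would need a larger entry. -/
theorem IsStandardFilling.exists_corner {μ : YoungDiagram} (hpos : 0 < μ.card)
    {f : ℕ × ℕ → ℕ} (hf : μ.IsStandardFilling f) :
    ∃ i ∈ μ.cornerRows, f (i, μ.rowLen i - 1) = μ.card := by
  obtain ⟨⟨i, j⟩, hc, hfc⟩ := hf.bijOn.surjOn (show μ.card ∈ Set.Icc 1 _ from ⟨hpos, le_rfl⟩)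
  have hc' : (i, j) ∈ μ := hc
  have h1 : ¬(i, j + 1) ∈ μ := fun h => by
    have := hf.row_lt _ hc' _ h rfl (Nat.lt_succ_self j)
    have := hf.le_card (i, j + 1)
    omega
  have h2 : ¬(i + 1, j) ∈ μ := fun h => by
    have := hf.col_lt _ hc' _ h rfl (Nat.lt_succ_self i)
    have := hf.le_card (i + 1, j)
    omega
  rw [mem_iff_lt_rowLen] at hc' h1 h2
  have hj : μ.rowLen i - 1 = j := by omega
  exact ⟨i, mem_cornerRows.2 (by omega), by rw [hj, hfc]⟩

theorem IsStandardFilling.update_zero {μ : YoungDiagram} {i : ℕ} (hi : i ∈ μ.cornerRows)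
    {f : ℕ × ℕ → ℕ} (hf : μ.IsStandardFilling f) (hfi : f (i, μ.rowLen i - 1) = μ.card) :
    (μ.removeCorner i).IsStandardFilling (Function.update f (i, μ.rowLen i - 1) 0) := by
  have hcard := card_removeCorner hi
  have hmem : ∀ {c}, c ∈ μ.removeCorner i → c ∈ μ ∧ c ≠ (i, μ.rowLen i - 1) :=
    fun hc => (mem_removeCorner hi).1 hc
  refine ⟨?_, ⟨?_, ?_, ?_⟩, ?_, ?_⟩
  · intro c hc
    rcases eq_or_ne c (i, μ.rowLen i - 1) with rfl | h
    · exact Function.update_self ..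
    · rw [Function.update_of_ne h]
      exact hf.eq_zero c fun hc' => hc ((mem_removeCorner hi).2 ⟨hc', h⟩)
  · intro c hc
    obtain ⟨h1, h2⟩ := hmem hc
    rw [Function.update_of_ne h2]
    have h3 := hf.bijOn.mapsTo h1
    have h4 : f c ≠ μ.card := fun h =>
      h2 (hf.bijOn.injOn h1 (corner_mem hi) (h.trans hfi.symm))
    have h5 := h3.2
    exact ⟨h3.1, by omega⟩
  · intro c hc d hd hcd
    rw [Function.update_of_ne (hmem hc).2, Function.update_of_ne (hmem hd).2] at hcd
    exact hf.bijOn.injOn (hmem hc).1 (hmem hd).1 hcd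
  · rintro m ⟨hm1, hm2⟩
    obtain ⟨c, hc, rfl⟩ := hf.bijOn.surjOn (show m ∈ Set.Icc 1 μ.card from ⟨hm1, by omega⟩)
    have hne : c ≠ (i, μ.rowLen i - 1) := by
      rintro rfl
      omega
    exact ⟨c, (mem_removeCorner hi).2 ⟨hc, hne⟩, Function.update_of_ne hne ..⟩
  · intro c hc d hd h1 h2
    rw [Function.update_of_ne (hmem hc).2, Function.update_of_ne (hmem hd).2]
    exact hf.row_lt c (hmem hc).1 d (hmem hd).1 h1 h2
  · intro c hc d hd h1 h2
    rw [Function.update_of_ne (hmem hc).2, Function.update_of_ne (hmem hd).2]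
    exact hf.col_lt c (hmem hc).1 d (hmem hd).1 h1 h2

/-- The branching rule. -/
theorem dim_eq_sum_removeCorner (μ : YoungDiagram) (hpos : 0 < μ.card) :
    μ.dim = ∑ i ∈ μ.cornerRows, (μ.removeCorner i).dim := by
  have hbij : Function.Bijective
      (fun p : (i : μ.cornerRows) × {g // (μ.removeCorner i).IsStandardFilling g} =>
        (⟨_, p.2.2.update_corner p.1.2⟩ : {f // μ.IsStandardFilling f})) := by
    constructor
    · rintro ⟨⟨i, hi⟩, g, hg⟩ ⟨⟨i', hi'⟩, g', hg'⟩ h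
      replace h := congrArg Subtype.val h
      dsimp only at h hg hg'
      -- The position of the largest entry determines the corner: the entries of `g'` are all
      -- smaller than `μ.card`.
      obtain rfl : i = i' := by
        by_contra hne
        have h1 := congrFun h (i, μ.rowLen i - 1)
        rw [Function.update_self, Function.update_of_ne fun h => hne (congrArg Prod.fst h)] at h1
        have h2 := hg'.le_card (i, μ.rowLen i - 1)
        have h3 := card_removeCorner hi'
        omega
      have hgg : g = g' := by
        funext c
        rcases eq_or_ne c (i, μ.rowLen i - 1) with rfl | hc
        · have hnot : (i, μ.rowLen i - 1) ∉ μ.removeCorner i :=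
            fun h => ((mem_removeCorner hi).1 h).2 rfl
          rw [hg.eq_zero _ hnot, hg'.eq_zero _ hnot]
        · simpa only [Function.update_of_ne hc] using congrFun h c
      subst hgg
      rfl
    · rintro ⟨f, hf⟩
      obtain ⟨i, hi, hfi⟩ := hf.exists_corner hpos
      refine ⟨⟨⟨i, hi⟩, _, hf.update_zero hi hfi⟩, Subtype.ext ?_⟩
      dsimp only
      rw [Function.update_idem, ← hfi, Function.update_eq_self]
  rw [dim_eq_card_standardFilling, ← Nat.card_congr (Equiv.ofBijective _ hbij), Nat.card_sigma]
  simp_rw [← dim_eq_card_standardFilling]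
  exact Finset.sum_coe_sort μ.cornerRows fun i => (μ.removeCorner i).dim

theorem dim_of_card_eq_zero {μ : YoungDiagram} (h : μ.card = 0) : μ.dim = 1 := by
  have hcells : μ.cells = ∅ := Finset.card_eq_zero.1 h
  have hnot : ∀ c, c ∉ μ := fun c hc => by
    rw [← mem_cells, hcells] at hc
    exact absurd hc (Finset.notMem_empty c)
  rw [dim_eq_card_standardFilling, Nat.card_eq_one_iff_exists]
  refine ⟨⟨fun _ => 0, fun _ _ => rfl, ?_, fun c hc => absurd hc (hnot c),
    fun c hc => absurd hc (hnot c)⟩, fun g => Subtype.ext (funext fun c => g.2.eq_zero c (hnot c))⟩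
  rw [hcells, h]
  simp

/-- The hook length formula. -/
theorem dim_mul_hookProd (μ : YoungDiagram) : μ.dim * μ.hookProd = μ.card.factorial := by
  induction hn : μ.card generalizing μ with
  | zero =>
    have hcells : μ.cells = ∅ := Finset.card_eq_zero.1 hn
    rw [dim_of_card_eq_zero hn, hookProd, hcells]
    rfl
  | succ n ih =>
    have hsum := μ.sum_hookProd_div
    have hdim : ((μ.dim : ℕ) : ℚ) =
        ∑ i ∈ μ.cornerRows, (n.factorial : ℚ) / (μ.removeCorner i).hookProd := by
      rw [μ.dim_eq_sum_removeCorner (by omega), Nat.cast_sum]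
      refine Finset.sum_congr rfl fun i hi => ?_
      have hcard := card_removeCorner hi
      have h0 : ((μ.removeCorner i).hookProd : ℚ) ≠ 0 := by
        exact_mod_cast (μ.removeCorner i).hookProd_pos.ne'
      rw [eq_div_iff h0, ← ih (μ.removeCorner i) (by omega), Nat.cast_mul]
    have : ((μ.dim : ℕ) : ℚ) * μ.hookProd = ((n + 1).factorial : ℕ) := by
      rw [Nat.factorial_succ, Nat.cast_mul, ← hn, ← hsum, hdim, Finset.sum_mul, Finset.sum_mul]
      refine Finset.sum_congr rfl fun i _ => ?_
      ring
    exact_mod_cast this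

end YoungDiagram

/-! ### Adding boxes to a diagram. -/

namespace YoungDiagram

section Addable

/-- The cell `c` can be added to `σ`. -/
def IsAddable (σ : YoungDiagram) (c : ℕ × ℕ) : Prop :=
  c.2 = σ.rowLen c.1 ∧ c.1 = σ.colLen c.2

/-- The union of `σ` and a set of addable cells. -/
def addCells (σ : YoungDiagram) (B : Finset (ℕ × ℕ)) (hB : ∀ b ∈ B, σ.IsAddable b) :
    YoungDiagram where
  cells := σ.cells ∪ B
  isLowerSet := by
    intro c d hdc hc
    simp only [Finset.coe_union, Set.mem_union, Finset.mem_coe] at hc ⊢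
    rcases hc with hc | hc
    · exact Or.inl (σ.isLowerSet hdc hc)
    · obtain ⟨h1, h2⟩ := hB c hc
      obtain ⟨hd1, hd2⟩ := Prod.mk_le_mk.1 hdc
      rcases hd1.lt_or_eq with h | h
      · exact Or.inl (σ.up_left_mem le_rfl hd2 (mem_iff_lt_colLen.2 (h2 ▸ h)))
      rcases hd2.lt_or_eq with h' | h'
      · exact Or.inl (σ.up_left_mem hd1 le_rfl (mem_iff_lt_rowLen.2 (h1 ▸ h')))
      · exact Or.inr (Prod.ext h h' ▸ hc)

variable {σ ν : YoungDiagram} {B : Finset (ℕ × ℕ)}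

theorem IsAddable.notMem {c : ℕ × ℕ} (h : σ.IsAddable c) : c ∉ σ := fun hc =>
  (mem_iff_lt_rowLen.1 hc).ne h.1

/-- An addable cell is determined by its row, so `B` has at most one cell in each row and an
indicator suffices. -/
theorem rowLen_of_cells_eq_union (hB : ∀ b ∈ B, σ.IsAddable b) (hν : ν.cells = σ.cells ∪ B)
    (i : ℕ) : ν.rowLen i = σ.rowLen i + if i ∈ B.image Prod.fst then 1 else 0 := by
  refine eq_of_forall_lt_iff fun j => ?_
  rw [← mem_iff_lt_rowLen, ← mem_cells, hν, Finset.mem_union, mem_cells, mem_iff_lt_rowLen]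
  split_ifs with h
  · obtain ⟨⟨a, b⟩, hb, rfl⟩ := Finset.mem_image.1 h
    have h1 : b = σ.rowLen a := (hB _ hb).1
    constructor
    · rintro (h | h)
      · exact Nat.lt_succ_of_lt h
      · rw [show j = σ.rowLen a from (hB _ h).1]
        exact Nat.lt_succ_self _
    · intro hj
      rcases (Nat.lt_succ_iff.1 hj).lt_or_eq with h | h
      · exact Or.inl h
      · right
        rwa [h, ← h1]
  · rw [add_zero, or_iff_left]
    exact fun hj => h (Finset.mem_image_of_mem Prod.fst hj)

theorem colLen_of_cells_eq_union (hB : ∀ b ∈ B, σ.IsAddable b) (hν : ν.cells = σ.cells ∪ B)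
    (j : ℕ) : ν.colLen j = σ.colLen j + if j ∈ B.image Prod.snd then 1 else 0 := by
  refine eq_of_forall_lt_iff fun i => ?_
  rw [← mem_iff_lt_colLen, ← mem_cells, hν, Finset.mem_union, mem_cells, mem_iff_lt_colLen]
  split_ifs with h
  · obtain ⟨⟨a, b⟩, hb, rfl⟩ := Finset.mem_image.1 h
    have h1 : a = σ.colLen b := (hB _ hb).2
    constructor
    · rintro (h | h)
      · exact Nat.lt_succ_of_lt h
      · rw [show i = σ.colLen b from (hB _ h).2]
        exact Nat.lt_succ_self _
    · intro hi
      rcases (Nat.lt_succ_iff.1 hi).lt_or_eq with h | h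
      · exact Or.inl h
      · right
        rwa [h, ← h1]
  · rw [add_zero, or_iff_left]
    exact fun hi => h (Finset.mem_image_of_mem Prod.snd hi)

/-- Adding addable cells lengthens the hooks of the cells in their rows and columns by one; the new
cells have hook length one. -/
theorem hookProd_of_cells_eq_union (hB : ∀ b ∈ B, σ.IsAddable b) (hν : ν.cells = σ.cells ∪ B) :
    ν.hookProd = ∏ c ∈ σ.cells, (σ.hookLength c + (if c.1 ∈ B.image Prod.fst then 1 else 0) +
      if c.2 ∈ B.image Prod.snd then 1 else 0) := by
  have hdisj : Disjoint σ.cells B :=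
    Finset.disjoint_left.2 fun c hc hb => (hB c hb).notMem hc
  rw [hookProd, hν, Finset.prod_union hdisj]
  have h1 : ∏ c ∈ B, ν.hookLength c = 1 := by
    refine Finset.prod_eq_one fun c hc => ?_
    obtain ⟨h1, h2⟩ := hB c hc
    rw [hookLength, rowLen_of_cells_eq_union hB hν, colLen_of_cells_eq_union hB hν,
      if_pos (Finset.mem_image_of_mem _ hc), if_pos (Finset.mem_image_of_mem _ hc)]
    omega
  rw [h1, mul_one]
  refine Finset.prod_congr rfl fun c hc => ?_
  have h2 : c.2 < σ.rowLen c.1 := mem_iff_lt_rowLen.1 hc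
  have h3 : c.1 < σ.colLen c.2 := mem_iff_lt_colLen.1 hc
  rw [hookLength, hookLength, rowLen_of_cells_eq_union hB hν, colLen_of_cells_eq_union hB hν]
  omega

end Addable

/-! ### Comparing two extensions of a symmetric diagram. -/

section Comparison

theorem IsSymmetric.colLen_eq {σ : YoungDiagram} (hσ : σ.IsSymmetric) (i : ℕ) :
    σ.colLen i = σ.rowLen i := by
  rw [← rowLen_transpose, show σ.transpose = σ from hσ]

theorem IsSymmetric.swap_mem {σ : YoungDiagram} (hσ : σ.IsSymmetric) {c : ℕ × ℕ} (hc : c ∈ σ) :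
    c.swap ∈ σ := by
  rwa [← mem_transpose, show σ.transpose = σ from hσ]

theorem IsSymmetric.hookLength_swap {σ : YoungDiagram} (hσ : σ.IsSymmetric) (c : ℕ × ℕ) :
    σ.hookLength c.swap = σ.hookLength c := by
  simp only [hookLength, hσ.colLen_eq, Prod.fst_swap, Prod.snd_swap]
  omega

/-- Reflection matches the two sides of the diagonal, so each cell can be treated together with its
mirror image. -/
theorem IsSymmetric.prod_cells {σ : YoungDiagram} (hσ : σ.IsSymmetric) (F : ℕ × ℕ → ℕ) :
    ∏ c ∈ σ.cells, F c =
      (∏ c ∈ σ.cells.filter fun c => c.1 = c.2, F c) *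
        ∏ c ∈ σ.cells.filter fun c => c.2 < c.1, F c * F c.swap := by
  have h1 : ∏ c ∈ σ.cells.filter (fun c => c.2 < c.1), F c.swap =
      ∏ c ∈ σ.cells.filter (fun c => c.1 < c.2), F c := by
    refine Finset.prod_bij' (fun c _ => c.swap) (fun c _ => c.swap) ?_ ?_ ?_ ?_ ?_
    · intro c hc
      rw [Finset.mem_filter] at hc ⊢
      exact ⟨hσ.swap_mem hc.1, hc.2⟩
    · intro c hc
      rw [Finset.mem_filter] at hc ⊢
      exact ⟨hσ.swap_mem hc.1, hc.2⟩
    all_goals simp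
  have h2 : (σ.cells.filter fun c => ¬c.1 = c.2).filter (fun c => c.2 < c.1) =
      σ.cells.filter fun c => c.2 < c.1 := by
    rw [Finset.filter_filter]
    exact Finset.filter_congr fun c _ => by omega
  have h3 : (σ.cells.filter fun c => ¬c.1 = c.2).filter (fun c => ¬c.2 < c.1) =
      σ.cells.filter fun c => c.1 < c.2 := by
    rw [Finset.filter_filter]
    exact Finset.filter_congr fun c _ => by omega
  rw [Finset.prod_mul_distrib, h1, ← h2, ← h3, Finset.prod_filter_mul_prod_filter_not,
    Finset.prod_filter_mul_prod_filter_not]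

theorem succ_sq_mul_lt {a b : ℕ} (hab : b < a) :
    (a + 1) * (a + 1) * (b * (b + 2)) < a * (a + 2) * ((b + 1) * (b + 1)) := by
  nlinarith

variable {σ : YoungDiagram} {U V : Finset (ℕ × ℕ)}

/-- Pairs of cells, one of `U` and one of `V`, the first one to the right of the second. -/
def crossPairs (U V : Finset (ℕ × ℕ)) : Finset ((ℕ × ℕ) × (ℕ × ℕ)) :=
  (U ×ˢ V ∪ V ×ˢ U).filter fun t => t.2.2 < t.1.2

theorem mem_crossPairs {t : (ℕ × ℕ) × (ℕ × ℕ)} :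
    t ∈ crossPairs U V ↔ (t.1 ∈ U ∧ t.2 ∈ V ∨ t.1 ∈ V ∧ t.2 ∈ U) ∧ t.2.2 < t.1.2 := by
  simp [crossPairs]

/-- Comparison of the hook products of two extensions of a symmetric diagram `σ`. The functions
`r` and `s` indicate the rows and columns that meet `U` or the reflection of `V`, the functions
`r'` and `s'` those that meet `U` or `V`. -/
theorem IsSymmetric.prod_hookLength_add_compare (hσ : σ.IsSymmetric)
    (hadd : ∀ k ∈ U ∪ V, σ.IsAddable k) (habove : ∀ k ∈ U ∪ V, k.2 < k.1)
    (hdisj : Disjoint U V) {r s r' s' : ℕ → ℕ}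
    (hU : ∀ k ∈ U, r k.1 = 1 ∧ s k.1 = 0 ∧ r k.2 = 0 ∧ s k.2 = 1)
    (hV : ∀ k ∈ V, r k.1 = 0 ∧ s k.1 = 1 ∧ r k.2 = 1 ∧ s k.2 = 0)
    (hUV : ∀ k ∈ U ∪ V, r' k.1 = 1 ∧ s' k.1 = 0 ∧ r' k.2 = 0 ∧ s' k.2 = 1)
    (hnone : ∀ i, (∀ k ∈ U ∪ V, i ≠ k.1 ∧ i ≠ k.2) →
      r i = 0 ∧ s i = 0 ∧ r' i = 0 ∧ s' i = 0) :
    ∏ c ∈ σ.cells, (σ.hookLength c + r' c.1 + s' c.2) ≤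
        ∏ c ∈ σ.cells, (σ.hookLength c + r c.1 + s c.2) ∧
      (U.Nonempty → V.Nonempty →
        ∏ c ∈ σ.cells, (σ.hookLength c + r' c.1 + s' c.2) <
          ∏ c ∈ σ.cells, (σ.hookLength c + r c.1 + s c.2)) := by
  classical
  have hr1 : ∀ k ∈ U ∪ V, σ.rowLen k.1 = k.2 := fun k hk => (hadd k hk).1.symm
  have hr2 : ∀ k ∈ U ∪ V, σ.rowLen k.2 = k.1 := fun k hk => by
    rw [← hσ.colLen_eq]
    exact (hadd k hk).2.symm
  have hl : ∀ k ∈ U, k ∈ U ∪ V := fun k hk => Finset.mem_union_left _ hk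
  have hr : ∀ k ∈ V, k ∈ U ∪ V := fun k hk => Finset.mem_union_right _ hk
  have hclass : ∀ i, (∃ k ∈ U, i = k.1) ∨ (∃ k ∈ U, i = k.2) ∨ (∃ k ∈ V, i = k.1) ∨
      (∃ k ∈ V, i = k.2) ∨ (r i = 0 ∧ s i = 0 ∧ r' i = 0 ∧ s' i = 0) := by
    intro i
    by_contra! h
    obtain ⟨h1, h2, h3, h4, h5⟩ := h
    obtain ⟨g1, g2, g3, g4⟩ := hnone i fun k hk => by
      rcases Finset.mem_union.1 hk with hk | hk
      · exact ⟨h1 k hk, h2 k hk⟩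
      · exact ⟨h3 k hk, h4 k hk⟩
    exact h5 g1 g2 g3 g4
  set F : ℕ × ℕ → ℕ := fun c => σ.hookLength c + r c.1 + s c.2 with hF
  set F' : ℕ × ℕ → ℕ := fun c => σ.hookLength c + r' c.1 + s' c.2 with hF'
  have hdiag : ∏ c ∈ σ.cells.filter (fun c => c.1 = c.2), F' c =
      ∏ c ∈ σ.cells.filter (fun c => c.1 = c.2), F c := by
    refine Finset.prod_congr rfl fun c hc => ?_
    have hc' := (Finset.mem_filter.1 hc).2
    have : r' c.2 + s' c.2 = r c.2 + s c.2 := by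
      rcases hclass c.2 with ⟨k, hk, h⟩ | ⟨k, hk, h⟩ | ⟨k, hk, h⟩ | ⟨k, hk, h⟩ | h
      · simp [h, hU k hk, hUV k (hl k hk)]
      · simp [h, hU k hk, hUV k (hl k hk)]
      · simp [h, hV k hk, hUV k (hr k hk)]
      · simp [h, hV k hk, hUV k (hr k hk)]
      · simp [h]
    simp only [hF, hF', hc']
    omega
  set L := σ.cells.filter (fun c => c.2 < c.1) with hL
  set G : ℕ × ℕ → ℕ := fun c => F c * F c.swap with hG
  set G' : ℕ × ℕ → ℕ := fun c => F' c * F' c.swap with hG'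
  have hGval : ∀ c, G c = (σ.hookLength c + r c.1 + s c.2) * (σ.hookLength c + r c.2 + s c.1) := by
    intro c
    simp only [hG, hF, hσ.hookLength_swap, Prod.fst_swap, Prod.snd_swap]
  have hGval' : ∀ c,
      G' c = (σ.hookLength c + r' c.1 + s' c.2) * (σ.hookLength c + r' c.2 + s' c.1) := by
    intro c
    simp only [hG', hF', hσ.hookLength_swap, Prod.fst_swap, Prod.snd_swap]
  set T := crossPairs U V with hT
  have hTmem : ∀ t ∈ T, t.1 ∈ U ∪ V ∧ t.2 ∈ U ∪ V ∧ t.2.2 < t.1.2 := by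
    intro t ht
    obtain ⟨h1 | h1, h2⟩ := mem_crossPairs.1 ht
    · exact ⟨hl _ h1.1, hr _ h1.2, h2⟩
    · exact ⟨hr _ h1.1, hl _ h1.2, h2⟩
  let φ : (ℕ × ℕ) × (ℕ × ℕ) → ℕ × ℕ := fun t => (t.1.2, t.2.2)
  let ψ : (ℕ × ℕ) × (ℕ × ℕ) → ℕ × ℕ := fun t => (t.1.1, t.2.2)
  have heq : ∀ k ∈ U ∪ V, ∀ l ∈ U ∪ V, k.2 = l.2 → k = l := fun k hk l hl h =>
    Prod.ext (by rw [← hr2 k hk, ← hr2 l hl, h]) h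
  have heq' : ∀ k ∈ U ∪ V, ∀ l ∈ U ∪ V, k.1 = l.1 → k = l := fun k hk l hl h =>
    Prod.ext h (by rw [← hr1 k hk, ← hr1 l hl, h])
  have hφinj : Set.InjOn φ T := by
    intro t ht u hu htu
    obtain ⟨h1, h2⟩ := Prod.mk.inj htu
    exact Prod.ext (heq _ (hTmem t ht).1 _ (hTmem u hu).1 h1)
      (heq _ (hTmem t ht).2.1 _ (hTmem u hu).2.1 h2)
  have hψinj : Set.InjOn ψ T := by
    intro t ht u hu htu
    obtain ⟨h1, h2⟩ := Prod.mk.inj htu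
    exact Prod.ext (heq' _ (hTmem t ht).1 _ (hTmem u hu).1 h1)
      (heq _ (hTmem t ht).2.1 _ (hTmem u hu).2.1 h2)
  -- A row indexed by the smaller coordinate of a box is longer than its index; one indexed by the
  -- larger coordinate is shorter.
  have hφψ : Disjoint (T.image φ) (T.image ψ) := by
    rw [Finset.disjoint_left]
    intro c hc hc'
    obtain ⟨t, ht, rfl⟩ := Finset.mem_image.1 hc
    obtain ⟨u, hu, hut⟩ := Finset.mem_image.1 hc'
    have h : u.1.1 = t.1.2 := (Prod.mk.inj hut).1
    have h1 := hr1 _ (hTmem u hu).1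
    have h2 := hr2 _ (hTmem t ht).1
    have h3 := habove _ (hTmem u hu).1
    have h4 := habove _ (hTmem t ht).1
    rw [h, h2] at h1
    omega
  have hsub : T.image φ ∪ T.image ψ ⊆ L := by
    intro c hc
    rcases Finset.mem_union.1 hc with hc | hc
    · obtain ⟨t, ht, rfl⟩ := Finset.mem_image.1 hc
      obtain ⟨h1, h2, h3⟩ := hTmem t ht
      refine Finset.mem_filter.2 ⟨mem_iff_lt_rowLen.2 ?_, h3⟩
      rw [hr2 _ h1]
      exact h3.trans (habove _ h1)
    · obtain ⟨t, ht, rfl⟩ := Finset.mem_image.1 hc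
      obtain ⟨h1, h2, h3⟩ := hTmem t ht
      refine Finset.mem_filter.2 ⟨mem_iff_lt_rowLen.2 ?_, h3.trans (habove _ h1)⟩
      rw [hr1 _ h1]
      exact h3
  have hsplit : ∀ g : ℕ × ℕ → ℕ, ∏ c ∈ L, g c =
      (∏ c ∈ L \ (T.image φ ∪ T.image ψ), g c) * ∏ t ∈ T, g (φ t) * g (ψ t) := by
    intro g
    rw [← Finset.prod_sdiff hsub, Finset.prod_union hφψ, Finset.prod_image hφinj,
      Finset.prod_image hψinj, Finset.prod_mul_distrib]
  -- Apart from the cells in the two images, no cell of `L` mixes the two classes: a column index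
  -- `l.1` would force `l.1 < k.2`, hence `k.2 ≤ l.2 < l.1`, a contradiction.
  have hcross : ∀ {i j k l}, (k ∈ U ∧ l ∈ V ∨ k ∈ V ∧ l ∈ U) → (i, j) ∈ L →
      (i, j) ∉ T.image φ ∪ T.image ψ → (i = k.1 ∨ i = k.2) → (j = l.1 ∨ j = l.2) → False := by
    intro i j k l hkl hij hnot hi hj
    obtain ⟨hk, hl⟩ : k ∈ U ∪ V ∧ l ∈ U ∪ V := by
      rcases hkl with h | h
      · exact ⟨hl _ h.1, hr _ h.2⟩
      · exact ⟨hr _ h.1, hl _ h.2⟩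
    obtain ⟨hmem, hlt⟩ := Finset.mem_filter.1 hij
    rw [mem_cells, mem_iff_lt_rowLen] at hmem
    dsimp only at hlt
    have hk1 := hr1 k hk
    have hl1 := hr1 l hl
    have hk2 := habove k hk
    have hl2 := habove l hl
    rcases hj with rfl | rfl
    · have hlk : l.1 < k.2 := by
        rcases hi with rfl | rfl
        · rwa [hk1] at hmem
        · exact hlt
      have := σ.rowLen_anti l.1 k.1 (by omega)
      omega
    · have hlk : l.2 < k.2 := by
        rcases hi with rfl | rfl
        · rwa [hk1] at hmem
        · exact hlt
      have ht : (k, l) ∈ T := mem_crossPairs.2 ⟨hkl, hlk⟩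
      refine hnot (Finset.mem_union.2 ?_)
      rcases hi with rfl | rfl
      · exact Or.inr (Finset.mem_image.2 ⟨_, ht, rfl⟩)
      · exact Or.inl (Finset.mem_image.2 ⟨_, ht, rfl⟩)
  have hrest : ∏ c ∈ L \ (T.image φ ∪ T.image ψ), G' c =
      ∏ c ∈ L \ (T.image φ ∪ T.image ψ), G c := by
    refine Finset.prod_congr rfl ?_
    rintro ⟨i, j⟩ hc
    obtain ⟨hcL, hcn⟩ := Finset.mem_sdiff.1 hc
    rw [hGval, hGval']
    dsimp only
    -- At an index from `U` nothing changes, at one from `V` the roles of `r` and `s` are exchanged.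
    -- If both indices of a cell are from `V`, or one is from `V` and the other from no box, this
    -- only permutes the two factors of `G`.
    have hvalU : ∀ {a k}, k ∈ U → (a = k.1 ∨ a = k.2) → r' a = r a ∧ s' a = s a := by
      rintro a k hk (rfl | rfl) <;> simp [hU k hk, hUV k (hl k hk)]
    have hvalV : ∀ {a k}, k ∈ V → (a = k.1 ∨ a = k.2) → r' a = s a ∧ s' a = r a := by
      rintro a k hk (rfl | rfl) <;> simp [hV k hk, hUV k (hr k hk)]
    have hclass2 : ∀ a, (∃ k ∈ U, a = k.1 ∨ a = k.2) ∨ (∃ k ∈ V, a = k.1 ∨ a = k.2) ∨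
        (r a = 0 ∧ s a = 0 ∧ r' a = 0 ∧ s' a = 0) := by
      intro a
      rcases hclass a with ⟨k, hk, h⟩ | ⟨k, hk, h⟩ | ⟨k, hk, h⟩ | ⟨k, hk, h⟩ | h
      · exact Or.inl ⟨k, hk, Or.inl h⟩
      · exact Or.inl ⟨k, hk, Or.inr h⟩
      · exact Or.inr (Or.inl ⟨k, hk, Or.inl h⟩)
      · exact Or.inr (Or.inl ⟨k, hk, Or.inr h⟩)
      · exact Or.inr (Or.inr h)
    rcases hclass2 i with ⟨k, hk, hi⟩ | ⟨k, hk, hi⟩ | ⟨i1, i2, i3, i4⟩ <;>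
      rcases hclass2 j with ⟨l, hl, hj⟩ | ⟨l, hl, hj⟩ | ⟨j1, j2, j3, j4⟩
    · rw [(hvalU hk hi).1, (hvalU hk hi).2, (hvalU hl hj).1, (hvalU hl hj).2]
    · exact (hcross (Or.inl ⟨hk, hl⟩) hcL hcn hi hj).elim
    · rw [(hvalU hk hi).1, (hvalU hk hi).2, j1, j2, j3, j4]
    · exact (hcross (Or.inr ⟨hk, hl⟩) hcL hcn hi hj).elim
    · rw [(hvalV hk hi).1, (hvalV hk hi).2, (hvalV hl hj).1, (hvalV hl hj).2]
      ring
    · rw [(hvalV hk hi).1, (hvalV hk hi).2, j1, j2, j3, j4]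
      ring
    · rw [(hvalU hl hj).1, (hvalU hl hj).2, i1, i2, i3, i4]
    · rw [(hvalV hl hj).1, (hvalV hl hj).2, i1, i2, i3, i4]
      ring
    · rw [i1, i2, i3, i4, j1, j2, j3, j4]
  have hpair : ∀ t ∈ T, G' (φ t) * G' (ψ t) < G (φ t) * G (ψ t) := by
    intro t ht
    obtain ⟨h1, h2, h3⟩ := hTmem t ht
    obtain ⟨p1, p2, p3, p4⟩ := hUV _ h1
    obtain ⟨q1, q2, q3, q4⟩ := hUV _ h2
    -- Both cells lie in one column, with `ψ t` in the later and shorter row.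
    have hlt : σ.hookLength (ψ t) < σ.hookLength (φ t) := by
      have g1 := habove _ h1
      have g2 := hr1 _ h1
      have g3 := hr2 _ h1
      have g4 : t.1.1 < σ.colLen t.2.2 := lt_rowLen_iff_lt_colLen.1 (by omega)
      simp only [hookLength, φ, ψ]
      omega
    have e1 : G' (φ t) = (σ.hookLength (φ t) + 1) * (σ.hookLength (φ t) + 1) := by
      rw [hGval']
      simp only [φ, p3, p4, q3, q4, add_zero]
    have e2 : G' (ψ t) = σ.hookLength (ψ t) * (σ.hookLength (ψ t) + 2) := by
      rw [hGval']
      simp only [ψ, p1, p2, q3, q4, add_zero]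
      ring
    have e3 : G (φ t) = σ.hookLength (φ t) * (σ.hookLength (φ t) + 2) ∧
        G (ψ t) = (σ.hookLength (ψ t) + 1) * (σ.hookLength (ψ t) + 1) := by
      rw [hGval, hGval]
      rcases (mem_crossPairs.1 ht).1 with ⟨hk, hl⟩ | ⟨hk, hl⟩
      · obtain ⟨a1, a2, a3, a4⟩ := hU _ hk
        obtain ⟨b1, b2, b3, b4⟩ := hV _ hl
        simp only [φ, ψ, a1, a2, a3, a4, b3, b4, add_zero, and_true]
      · obtain ⟨a1, a2, a3, a4⟩ := hV _ hk
        obtain ⟨b1, b2, b3, b4⟩ := hU _ hl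
        simp only [φ, ψ, a1, a2, a3, a4, b3, b4, add_zero, and_true]
        ring
    rw [e1, e2, e3.1, e3.2]
    exact succ_sq_mul_lt hlt
  have hFpos : ∀ c, 0 < F c := fun c => by
    have := σ.hookLength_pos c
    simp only [hF]
    omega
  have hFpos' : ∀ c, 0 < F' c := fun c => by
    have := σ.hookLength_pos c
    simp only [hF']
    omega
  have hGpos : ∀ c, 0 < G c := fun c => Nat.mul_pos (hFpos c) (hFpos _)
  have hGpos' : ∀ c, 0 < G' c := fun c => Nat.mul_pos (hFpos' c) (hFpos' _)
  rw [hσ.prod_cells F, hσ.prod_cells F', hdiag]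
  change _ * ∏ c ∈ L, G' c ≤ _ * ∏ c ∈ L, G c ∧ (_ → _ → _ * ∏ c ∈ L, G' c < _ * ∏ c ∈ L, G c)
  rw [hsplit G, hsplit G', hrest]
  constructor
  · exact Nat.mul_le_mul_left _ (Nat.mul_le_mul_left _
      (Finset.prod_le_prod' fun t ht => (hpair t ht).le))
  · rintro ⟨k, hk⟩ ⟨l, hl'⟩
    have hne : T.Nonempty := by
      have hkl : k.2 ≠ l.2 := fun h => by
        have := heq k (hl k hk) l (hr l hl') h
        exact Finset.disjoint_left.1 hdisj hk (this ▸ hl')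
      rcases lt_or_gt_of_ne hkl with h | h
      · exact ⟨(l, k), mem_crossPairs.2 ⟨Or.inr ⟨hl', hk⟩, h⟩⟩
      · exact ⟨(k, l), mem_crossPairs.2 ⟨Or.inl ⟨hk, hl'⟩, h⟩⟩
    refine Nat.mul_lt_mul_of_pos_left (Nat.mul_lt_mul_of_pos_left ?_ ?_) ?_
    · exact Finset.prod_lt_prod_of_nonempty
        (fun t _ => Nat.mul_pos (hGpos' _) (hGpos' _)) hpair hne
    · exact Finset.prod_pos fun c _ => hGpos c
    · exact Finset.prod_pos fun c _ => hFpos c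

end Comparison

end YoungDiagram

/-! ### The boxes outside the base subdiagram, and the main theorem. -/

namespace YoungDiagram

theorem isSymmetric_baseSubdiagram (μ : YoungDiagram) : μ.baseSubdiagram.IsSymmetric :=
  μ.isGreatest_baseSubdiagram.1.1

theorem mem_baseSubdiagram {μ : YoungDiagram} {c : ℕ × ℕ} :
    c ∈ μ.baseSubdiagram ↔ c ∈ μ ∧ c.swap ∈ μ := by
  rw [baseSubdiagram, mem_inf, mem_transpose]

theorem mem_asymBoxes {μ : YoungDiagram} {c : ℕ × ℕ} :
    c ∈ μ.asymBoxes ↔ c ∈ μ ∧ c.swap ∉ μ := by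
  rw [asymBoxes, Finset.mem_sdiff, mem_cells, mem_cells, mem_baseSubdiagram]
  tauto

theorem cells_eq_base_union_asymBoxes (μ : YoungDiagram) :
    μ.cells = μ.baseSubdiagram.cells ∪ μ.asymBoxes := by
  rw [asymBoxes, Finset.union_sdiff_of_subset]
  exact Finset.inter_subset_left

theorem asymBoxes_eq_union (μ : YoungDiagram) : μ.asymBoxes = μ.asymAbove ∪ μ.asymBelow := by
  rw [asymAbove, asymBelow, ← Finset.filter_or, Finset.filter_true_of_mem]
  rintro ⟨a, b⟩ hc
  obtain ⟨h1, h2⟩ := mem_asymBoxes.1 hc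
  have : a ≠ b := by
    rintro rfl
    exact h2 h1
  dsimp only
  omega

/-- If each row and each column contains at most one box of `asymBoxes`, these boxes are addable to
the base subdiagram. -/
theorem isAddable_of_mem_asymBoxes {μ : YoungDiagram}
    (hrow : ∀ i : ℕ, (μ.asymBoxes.filter fun c => c.1 = i).card ≤ 1)
    (hcol : ∀ j : ℕ, (μ.asymBoxes.filter fun c => c.2 = j).card ≤ 1)
    {c : ℕ × ℕ} (hc : c ∈ μ.asymBoxes) : μ.baseSubdiagram.IsAddable c := by
  obtain ⟨h1, h2⟩ := mem_asymBoxes.1 hc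
  have hnot : c ∉ μ.baseSubdiagram := fun h => h2 (mem_baseSubdiagram.1 h).2
  obtain ⟨i, j⟩ := c
  constructor
  · refine le_antisymm ?_ ?_
    · by_contra! hlt
      dsimp only at hlt
      -- The first position after the base in this row would be a second box of A in the row.
      have hd : (i, μ.baseSubdiagram.rowLen i) ∈ μ.asymBoxes :=
        Finset.mem_sdiff.2 ⟨μ.up_left_mem le_rfl hlt.le h1,
          fun h => lt_irrefl _ (mem_iff_lt_rowLen.1 h)⟩
      have := Finset.card_le_one.1 (hrow i) _ (Finset.mem_filter.2 ⟨hc, rfl⟩) _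
        (Finset.mem_filter.2 ⟨hd, rfl⟩)
      exact hlt.ne' (Prod.mk.inj this).2
    · by_contra! hlt
      exact hnot (mem_iff_lt_rowLen.2 hlt)
  · refine le_antisymm ?_ ?_
    · by_contra! hlt
      dsimp only at hlt
      have hd : (μ.baseSubdiagram.colLen j, j) ∈ μ.asymBoxes :=
        Finset.mem_sdiff.2 ⟨μ.up_left_mem hlt.le le_rfl h1,
          fun h => lt_irrefl _ (mem_iff_lt_colLen.1 h)⟩
      have := Finset.card_le_one.1 (hcol j) _ (Finset.mem_filter.2 ⟨hc, rfl⟩) _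
        (Finset.mem_filter.2 ⟨hd, rfl⟩)
      exact hlt.ne' (Prod.mk.inj this).1
    · by_contra! hlt
      exact hnot (mem_iff_lt_colLen.2 hlt)

theorem IsSymmetric.isAddable_swap {σ : YoungDiagram} (hσ : σ.IsSymmetric) {c : ℕ × ℕ}
    (hc : σ.IsAddable c) : σ.IsAddable c.swap := by
  obtain ⟨h1, h2⟩ := hc
  refine ⟨?_, ?_⟩
  · rw [Prod.snd_swap, Prod.fst_swap, ← hσ.colLen_eq]
    exact h2
  · rw [Prod.snd_swap, Prod.fst_swap, hσ.colLen_eq]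
    exact h1

theorem dim_le_of_hookProd_le {μ ν : YoungDiagram} (hcard : ν.card = μ.card)
    (h : ν.hookProd ≤ μ.hookProd) : μ.dim ≤ ν.dim := by
  have h1 := μ.dim_mul_hookProd
  have h2 := ν.dim_mul_hookProd
  rw [hcard, ← h1] at h2
  exact Nat.le_of_mul_le_mul_right (h2 ▸ Nat.mul_le_mul_left _ h) μ.hookProd_pos

theorem dim_lt_of_hookProd_lt {μ ν : YoungDiagram} (hcard : ν.card = μ.card)
    (h : ν.hookProd < μ.hookProd) : μ.dim < ν.dim := by
  have h1 := μ.dim_mul_hookProd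
  have h2 := ν.dim_mul_hookProd
  have hpos : 0 < ν.dim := Nat.pos_of_ne_zero fun h0 => by
    rw [h0, zero_mul] at h2
    exact (Nat.factorial_pos _).ne h2
  rw [hcard, ← h1] at h2
  exact Nat.lt_of_mul_lt_mul_right (h2 ▸ Nat.mul_lt_mul_of_pos_left h hpos)

end YoungDiagram

open YoungDiagram in
theorem mainTheorem1 (μ : YoungDiagram)
    (hrow : ∀ i : ℕ, (μ.asymBoxes.filter fun c => c.1 = i).card ≤ 1)
    (hcol : ∀ j : ℕ, (μ.asymBoxes.filter fun c => c.2 = j).card ≤ 1) :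
    ∃ μ' : YoungDiagram,
      μ'.cells = μ.baseSubdiagram.cells ∪ μ.asymAbove ∪ μ.asymBelow.image Prod.swap ∧
      μ'.card = μ.card ∧
      μ.dim ≤ μ'.dim ∧
      (μ.asymAbove.Nonempty → μ.asymBelow.Nonempty → μ.dim < μ'.dim) := by
  set σ := μ.baseSubdiagram with hσdef
  have hσ : σ.IsSymmetric := μ.isSymmetric_baseSubdiagram
  set U := μ.asymAbove with hU
  set V := μ.asymBelow.image Prod.swap with hV
  have hA : ∀ c ∈ μ.asymBoxes, σ.IsAddable c := fun c => isAddable_of_mem_asymBoxes hrow hcol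
  have hUA : ∀ k ∈ U, k ∈ μ.asymBoxes := fun k hk => (Finset.mem_filter.1 hk).1
  have hVbelow : ∀ k ∈ V, k.swap ∈ μ.asymBelow := fun k hk => by
    obtain ⟨c, hc, rfl⟩ := Finset.mem_image.1 hk
    rwa [Prod.swap_swap]
  have hVA : ∀ k ∈ V, k.swap ∈ μ.asymBoxes := fun k hk => (Finset.mem_filter.1 (hVbelow k hk)).1
  have hadd : ∀ k ∈ U ∪ V, σ.IsAddable k := fun k hk => by
    rcases Finset.mem_union.1 hk with h | h
    · exact hA k (hUA k h)
    · simpa using hσ.isAddable_swap (hA _ (hVA k h))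
  have habove : ∀ k ∈ U ∪ V, k.2 < k.1 := fun k hk => by
    rcases Finset.mem_union.1 hk with h | h
    · exact (Finset.mem_filter.1 h).2
    · exact (Finset.mem_filter.1 (hVbelow k h)).2
  have hasym : ∀ k ∈ μ.asymBoxes, k.swap ∉ μ.asymBoxes := fun k hk h =>
    (mem_asymBoxes.1 hk).2 (mem_asymBoxes.1 h).1
  have hdisj : Disjoint U V := Finset.disjoint_left.2 fun k hk hk' =>
    hasym k (hUA k hk) (hVA k hk')
  -- If the row of `a` equalled the column of `b`, symmetry of the base would make them mirror
  -- images, but a box of A has its mirror image outside `μ`. So no index is both a row and a column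
  -- of A.
  have hcross : ∀ a ∈ μ.asymBoxes, ∀ b ∈ μ.asymBoxes, a.1 ≠ b.2 := by
    intro a ha b hb hab
    have h : a.2 = b.1 := by rw [(hA a ha).1, hab, ← hσ.colLen_eq, ← (hA b hb).2]
    exact hasym b hb (by rwa [show b.swap = a from Prod.ext hab.symm h.symm])
  have hcross' : ∀ a ∈ U ∪ V, ∀ b ∈ U ∪ V, a.1 ≠ b.2 := by
    intro a ha b hb hab
    have h : a.2 = b.1 := by rw [(hadd a ha).1, hab, ← hσ.colLen_eq, ← (hadd b hb).2]
    have h1 := habove a ha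
    have h2 := habove b hb
    omega
  have hcells : (σ.addCells (U ∪ V) hadd).cells = σ.cells ∪ (U ∪ V) := rfl
  have hfst : ∀ {B : Finset (ℕ × ℕ)} {k}, k ∈ B →
      (if k.1 ∈ B.image Prod.fst then 1 else 0) = 1 := fun hk =>
    if_pos (Finset.mem_image_of_mem _ hk)
  have hsnd : ∀ {B : Finset (ℕ × ℕ)} {k}, k ∈ B →
      (if k.2 ∈ B.image Prod.snd then 1 else 0) = 1 := fun hk =>
    if_pos (Finset.mem_image_of_mem _ hk)
  have hfst0 : ∀ {B : Finset (ℕ × ℕ)} {i}, (∀ k ∈ B, k.1 ≠ i) →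
      (if i ∈ B.image Prod.fst then 1 else 0) = 0 := fun h => if_neg fun hi => by
    obtain ⟨k, hk, hki⟩ := Finset.mem_image.1 hi
    exact h k hk hki
  have hsnd0 : ∀ {B : Finset (ℕ × ℕ)} {i}, (∀ k ∈ B, k.2 ≠ i) →
      (if i ∈ B.image Prod.snd then 1 else 0) = 0 := fun h => if_neg fun hi => by
    obtain ⟨k, hk, hki⟩ := Finset.mem_image.1 hi
    exact h k hk hki
  have hmemUV : ∀ a ∈ μ.asymBoxes, a ∈ U ∪ V ∨ a.swap ∈ U ∪ V := by
    intro a ha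
    rw [asymBoxes_eq_union, Finset.mem_union] at ha
    rcases ha with h | h
    · exact Or.inl (Finset.mem_union_left _ h)
    · exact Or.inr (Finset.mem_union_right _ (Finset.mem_image_of_mem _ h))
  have hcompare := hσ.prod_hookLength_add_compare hadd habove hdisj
    (r := fun i => if i ∈ μ.asymBoxes.image Prod.fst then 1 else 0)
    (s := fun i => if i ∈ μ.asymBoxes.image Prod.snd then 1 else 0)
    (r' := fun i => if i ∈ (U ∪ V).image Prod.fst then 1 else 0)
    (s' := fun i => if i ∈ (U ∪ V).image Prod.snd then 1 else 0)
    (fun k hk => ⟨hfst (hUA k hk), hsnd0 fun a ha h => hcross k (hUA k hk) a ha h.symm,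
      hfst0 fun a ha h => hcross a ha k (hUA k hk) h, hsnd (hUA k hk)⟩)
    (fun k hk => ⟨hfst0 fun a ha h => hcross a ha _ (hVA k hk) h, hsnd (hVA k hk),
      hfst (hVA k hk), hsnd0 fun a ha h => hcross _ (hVA k hk) a ha h.symm⟩)
    (fun k hk => ⟨hfst hk, hsnd0 fun a ha h => hcross' k hk a ha h.symm,
      hfst0 fun a ha h => hcross' a ha k hk h, hsnd hk⟩)
    (fun i hi => ⟨hfst0 fun a ha h => (hmemUV a ha).elim (fun h' => (hi _ h').1 h.symm)
        fun h' => (hi _ h').2 h.symm,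
      hsnd0 fun a ha h => (hmemUV a ha).elim (fun h' => (hi _ h').2 h.symm)
        fun h' => (hi _ h').1 h.symm,
      hfst0 fun a ha h => (hi a ha).1 h.symm, hsnd0 fun a ha h => (hi a ha).2 h.symm⟩)
  rw [← hookProd_of_cells_eq_union hadd hcells,
    ← hookProd_of_cells_eq_union hA μ.cells_eq_base_union_asymBoxes] at hcompare
  have hcard : (σ.addCells (U ∪ V) hadd).card = μ.card := by
    have hd1 : Disjoint σ.cells (U ∪ V) :=
      Finset.disjoint_left.2 fun c hc hb => (hadd c hb).notMem hc
    have hd2 : Disjoint σ.cells μ.asymBoxes := Finset.disjoint_sdiff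
    have hd3 : Disjoint U μ.asymBelow := Finset.disjoint_left.2 fun c hc hb =>
      lt_asymm (Finset.mem_filter.1 hc).2 (Finset.mem_filter.1 hb).2
    rw [YoungDiagram.card, YoungDiagram.card, hcells, μ.cells_eq_base_union_asymBoxes,
      Finset.card_union_of_disjoint hd1, Finset.card_union_of_disjoint hd2, asymBoxes_eq_union,
      Finset.card_union_of_disjoint hdisj, Finset.card_union_of_disjoint hd3,
      Finset.card_image_of_injective _ Prod.swap_injective]
  refine ⟨σ.addCells (U ∪ V) hadd, ?_, hcard, dim_le_of_hookProd_le hcard hcompare.1,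
    fun h1 h2 => dim_lt_of_hookProd_lt hcard (hcompare.2 h1 (h2.image _))⟩
  rw [hcells, Finset.union_assoc]
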